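/- Theorem. For a real number $q\neq 0$, the $q$-Laplacian matrix of a simple graph $G$ with adjacency matrix $A$, degree matrix $\Delta$ and Laplacian matrix $L=\Delta-A$ is $$\mathscr{L}_q=qL-(q-1)I+q(q-1)(\Delta-I),$$ and $U_q(t)=\exp(it\mathscr{L}_q)$, $t\in\mathbb{R}$, is its transition matrix. The graph $G$ has $q$-Laplacian vertex pretty good state transfer (PGST) between distinct vertices $a$ and $b$ if there are a complex number $\gamma$ with $|\gamma|=1$ and a sequence of real numbers $(\tau_k)$ such that $\lim_{k\to\infty}U_q(\tau_k)\mathbf{e}_a=\gamma\,\mathbf{e}_b$, where $\mathbf{e}_v$ denotes the characteristic vector of the vertex $v$. Let $n\ge 2$ and let $P_n$ be the path on the vertices $1,\dots,n$, in which $j$ and $k$ are adjacent exactly when $|j-k|=1$. Then there exists a real number $q\neq 0$ such that $P_n$ has $q$-Laplacian vertex PGST between its end vertices $1$ and $n$. -/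

import Mathlib

open Matrix Filter Topology

noncomputable section

namespace QLaplacian

variable {V : Type*} [Fintype V] [DecidableEq V]

/-- The `q`-Laplacian matrix `q L - (q - 1) I + q (q - 1) (Δ - I)` of a graph, where `L` is the
Laplacian matrix and `Δ` the degree matrix. -/
def qLapMatrix (G : SimpleGraph V) [DecidableRel G.Adj] (q : ℝ) : Matrix V V ℝ :=
  q • G.lapMatrix ℝ - (q - 1) • (1 : Matrix V V ℝ) + (q * (q - 1)) • (G.degMatrix ℝ - 1)

/-- The transition matrix `U_M(t) = exp (i t M)` of the continuous-time quantum walk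
governed by a real matrix `M`. -/
def transitionMatrix (M : Matrix V V ℝ) (t : ℝ) : Matrix V V ℂ :=
  NormedSpace.exp ((Complex.I * (t : ℂ)) • M.map Complex.ofReal)

/-- A real vector that represents a real pure state: a unit vector for the Euclidean norm. -/
def IsState (x : V → ℝ) : Prop := x ⬝ᵥ x = 1

/-- The state attached to a vertex: its characteristic vector. -/
def vertexState (a : V) : V → ℝ := Pi.single a 1

/-- Pretty good state transfer, relative to `M`, between two linearly independent states `x`
and `y`: for some complex `γ` of modulus one and some sequence of real times `τ k`, the vectors
`U_M(τ k) x` converge to `γ y`. -/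
def HasPGST (M : Matrix V V ℝ) (x y : V → ℝ) : Prop :=
  IsState x ∧ IsState y ∧ LinearIndependent ℝ ![x, y] ∧
    ∃ (γ : ℂ) (τ : ℕ → ℝ), ‖γ‖ = 1 ∧
      Tendsto (fun k => transitionMatrix M (τ k) *ᵥ (fun v => (x v : ℂ))) atTop
        (𝓝 (γ • fun v => (y v : ℂ)))

/-- Vertex PGST between the vertices `a` and `b` of `G` relative to its `q`-Laplacian matrix. -/
def HasVertexPGST (G : SimpleGraph V) [DecidableRel G.Adj] (q : ℝ) (a b : V) : Prop :=
  HasPGST (qLapMatrix G q) (vertexState a) (vertexState b)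

/-- Adjacency in the path graph is decidable: it compares values in `Fin n`. -/
instance pathGraphDecidableAdj (n : ℕ) : DecidableRel (SimpleGraph.pathGraph n).Adj :=
  fun _ _ => decidable_of_iff' _ SimpleGraph.pathGraph_adj

end QLaplacian

end

/-! Take `q` transcendental. On the path, `L_q = (q² + 1) I - q (A + q E)`, with `E` the projection
onto the two ends, so eigenvalues are `q² + 1 - q θ` with `θ` an eigenvalue of the path with
potential `q` at its ends. Reflection makes each eigenvector symmetric or antisymmetric, with sign
`s = ±1`, and `exists_pencil_root` makes `θ` a root of some `wₖ₊₁ - q wₖ`. That polynomial has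
degree one in `q` and coprime coefficients, so it is irreducible over `ℚ(q)`, and the mean of the
conjugates of `θ` is `(d + q)/(k + 1)`. Taking normalised traces of an integer relation among the
eigenvalues and comparing powers of `q` gives three rational relations
(`relations_of_pencil_roots`). The sign is a fixed combination of `1`, `d/(k + 1)` and `1/(k + 1)`,
so the relation also kills the signs. Kronecker's theorem then yields times at which all phases
approach the signs, which is PGST with `γ = 1`. -/

noncomputable section

/-! ### Kronecker approximation on the torus. -/

section Kronecker

variable {ι : Type*}

/-- The linear flow of velocity `θ` on the torus. -/
def torusFlow (θ : ι → ℝ) (t : ℝ) : UnitAddTorus ι := fun i => ((t * θ i : ℝ) : UnitAddCircle)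

lemma torusFlow_add (θ : ι → ℝ) (s t : ℝ) :
    torusFlow θ (s + t) = torusFlow θ s + torusFlow θ t := by
  ext i
  simp [torusFlow, add_mul]

@[fun_prop]
lemma continuous_torusFlow (θ : ι → ℝ) : Continuous (torusFlow θ) :=
  continuous_pi fun i => (AddCircle.continuous_mk' 1).comp (by fun_prop)

variable [Fintype ι]

lemma mFourier_add_apply (l : ι → ℤ) (x y : UnitAddTorus ι) :
    UnitAddTorus.mFourier l (x + y) =
      UnitAddTorus.mFourier l x * UnitAddTorus.mFourier l y := by
  simp [UnitAddTorus.mFourier, fourier_apply, smul_add, AddCircle.toCircle_add,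
    Finset.prod_mul_distrib]

lemma mFourier_eq_one {l : ι → ℤ} {x : UnitAddTorus ι} (h : ∑ i, l i • x i = 0) :
    UnitAddTorus.mFourier l x = 1 := by
  have key : ∀ s : Finset ι, ∏ i ∈ s, (fourier (l i) (x i) : ℂ) =
      (AddCircle.toCircle (∑ i ∈ s, l i • x i) : ℂ) := by
    intro s
    induction s using Finset.cons_induction with
    | empty => simp
    | cons a s ha ih =>
      rw [Finset.prod_cons, Finset.sum_cons, ih, AddCircle.toCircle_add, fourier_apply]
      simp
  rw [UnitAddTorus.mFourier, ContinuousMap.coe_mk, key, h]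
  simp

lemma mFourier_torusFlow (l : ι → ℤ) (θ : ι → ℝ) (t : ℝ) :
    UnitAddTorus.mFourier l (torusFlow θ t) =
      Complex.exp ((2 * Real.pi * (∑ i, l i * θ i : ℝ) * Complex.I) * t) := by
  simp only [UnitAddTorus.mFourier, ContinuousMap.coe_mk, torusFlow, fourier_coe_apply]
  rw [← Complex.exp_sum]
  congr 1
  push_cast
  rw [Finset.mul_sum, Finset.sum_mul, Finset.sum_mul]
  exact Finset.sum_congr rfl fun i _ => by ring

lemma tendsto_average_exp {c : ℝ} (hc : c ≠ 0) :
    Tendsto (fun T : ℝ => (T : ℂ)⁻¹ * ∫ t in (0 : ℝ)..T,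
      Complex.exp ((2 * Real.pi * c * Complex.I) * t)) atTop (𝓝 0) := by
  have ha : (2 * Real.pi * c * Complex.I : ℂ) ≠ 0 := by
    simp [hc, Real.pi_ne_zero]
  simp only [integral_exp_mul_complex ha]
  refine squeeze_zero_norm' (a := fun T : ℝ => T⁻¹ * (2 / ‖(2 * Real.pi * c * Complex.I : ℂ)‖))
    ?_ ?_
  · filter_upwards [eventually_gt_atTop 0] with T hT
    rw [norm_mul, norm_inv, Complex.norm_real, Real.norm_of_nonneg hT.le, norm_div]
    gcongr
    refine (norm_sub_le _ _).trans ?_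
    have : ∀ x : ℝ, ‖Complex.exp (2 * Real.pi * c * Complex.I * x)‖ = 1 := fun x => by
      rw [← Complex.norm_exp_ofReal_mul_I (2 * Real.pi * c * x)]
      congr 2; push_cast; ring
    rw [this, this]; norm_num
  · simpa using tendsto_inv_atTop_zero.mul_const (2 / ‖(2 * Real.pi * c * Complex.I : ℂ)‖)

/-- A character either oscillates along the flow, so that its average vanishes, or is constant along
it, and then `h` makes it trivial at `z`. -/
lemma tendsto_average_sub (θ : ι → ℝ) (z : UnitAddTorus ι)
    (h : ∀ l : ι → ℤ, ∑ i, l i * θ i = 0 → ∑ i, l i • z i = 0)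
    {g : C(UnitAddTorus ι, ℂ)}
    (hg : g ∈ Submodule.span ℂ (Set.range (UnitAddTorus.mFourier (d := ι)))) :
    Tendsto (fun T : ℝ => (T : ℂ)⁻¹ * ∫ t in (0 : ℝ)..T,
      (g (torusFlow θ t) - g (torusFlow θ t + z))) atTop (𝓝 0) := by
  have hint : ∀ (f : C(UnitAddTorus ι, ℂ)) (T : ℝ), IntervalIntegrable
      (fun t => f (torusFlow θ t) - f (torusFlow θ t + z)) MeasureTheory.volume 0 T :=
    fun f T => (by fun_prop : Continuous _).intervalIntegrable _ _
  induction hg using Submodule.span_induction with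
  | mem g hg =>
    obtain ⟨l, rfl⟩ := hg
    have e : ∀ t, UnitAddTorus.mFourier l (torusFlow θ t) -
        UnitAddTorus.mFourier l (torusFlow θ t + z) = (1 - UnitAddTorus.mFourier l z) *
        Complex.exp ((2 * Real.pi * (∑ i, l i * θ i : ℝ) * Complex.I) * t) := fun t => by
      rw [mFourier_add_apply, mFourier_torusFlow]; ring
    simp only [e, intervalIntegral.integral_const_mul]
    by_cases hl : ∑ i, l i * θ i = 0
    · simp [mFourier_eq_one (h l hl)]
    · simpa [mul_left_comm] using
        (tendsto_average_exp hl).const_mul (1 - UnitAddTorus.mFourier l z)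
  | zero => simp
  | add f g _ _ hf hg =>
    refine (by simpa using hf.add hg : Tendsto _ _ (𝓝 (0 : ℂ))).congr fun T => ?_
    rw [← mul_add, ← intervalIntegral.integral_add (hint f T) (hint g T)]
    congr 1
    refine intervalIntegral.integral_congr fun t _ => ?_
    simp only [ContinuousMap.add_apply]; ring
  | smul a f _ hf =>
    refine (by simpa using hf.const_mul a : Tendsto _ _ (𝓝 (0 : ℂ))).congr fun T => ?_
    rw [mul_left_comm, ← intervalIntegral.integral_const_mul]
    congr 1
    refine intervalIntegral.integral_congr fun t _ => ?_
    simp only [ContinuousMap.smul_apply, smul_eq_mul]; ring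

/-- **Kronecker's approximation theorem**: a point of the torus that satisfies every integer
relation between the velocities is approximated by the linear flow. -/
theorem exists_dist_torusFlow_lt (θ : ι → ℝ) (z : UnitAddTorus ι)
    (h : ∀ l : ι → ℤ, ∑ i, l i * θ i = 0 → ∑ i, l i • z i = 0) {ε : ℝ} (hε : 0 < ε) :
    ∃ t : ℝ, dist (torusFlow θ t) z < ε := by
  by_contra! hfar
  set A : Set (UnitAddTorus ι) := Set.range (torusFlow θ)
  -- The distance to the orbit vanishes on the orbit and, as the orbit is a subgroup missing the
  -- `ε`-ball at `z`, is at least `ε` on its translate by `z`. A trigonometric polynomial `ε /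
  -- 4`-close to it keeps a gap of `ε / 2`, against equality of the averages.
  let f : C(UnitAddTorus ι, ℂ) :=
    ⟨fun x => (Metric.infDist x A : ℂ),
      Complex.continuous_ofReal.comp (Metric.continuous_infDist_pt A)⟩
  have hfA : ∀ t, f (torusFlow θ t) = 0 := fun t => by
    simpa [f] using Metric.infDist_zero_of_mem (Set.mem_range_self t : torusFlow θ t ∈ A)
  have hfz : ∀ t, ε ≤ (f (torusFlow θ t + z)).re := fun t => by
    simp only [f, ContinuousMap.coe_mk, Complex.ofReal_re]
    refine (Metric.le_infDist (Set.range_nonempty _)).2 ?_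
    rintro _ ⟨s, rfl⟩
    have e : torusFlow θ s = torusFlow θ t + torusFlow θ (s - t) := by
      rw [← torusFlow_add]; congr 1; ring
    rw [e, dist_add_left, dist_comm]
    exact hfar _
  have hmem : f ∈ closure (Submodule.span ℂ (Set.range (UnitAddTorus.mFourier (d := ι))) :
      Set C(UnitAddTorus ι, ℂ)) := by
    rw [← Submodule.topologicalClosure_coe, UnitAddTorus.span_mFourier_closure_eq_top]
    trivial
  obtain ⟨g, hg, hfg⟩ := Metric.mem_closure_iff.1 hmem (ε / 4) (by positivity)
  have hre : ∀ x, |(f x).re - (g x).re| ≤ ε / 4 := fun x => by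
    rw [← Complex.sub_re]
    refine (Complex.abs_re_le_norm _).trans ?_
    rw [← dist_eq_norm]
    exact (ContinuousMap.dist_apply_le_dist x).trans hfg.le
  have hlim := (Complex.continuous_re.tendsto _).comp (tendsto_average_sub θ z h hg)
  have hle : ∀ᶠ T : ℝ in atTop, ((T : ℂ)⁻¹ * ∫ t in (0 : ℝ)..T,
      (g (torusFlow θ t) - g (torusFlow θ t + z))).re ≤ -(ε / 2) := by
    filter_upwards [eventually_gt_atTop 0] with T hT
    have hc : Continuous fun t => g (torusFlow θ t) - g (torusFlow θ t + z) := by fun_prop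
    have e := Complex.reCLM.intervalIntegral_comp_comm (hc.intervalIntegrable
      (μ := MeasureTheory.volume) 0 T)
    simp only [Complex.reCLM_apply] at e
    rw [← Complex.ofReal_inv, Complex.re_ofReal_mul, ← e]
    have hm := intervalIntegral.integral_mono_on (μ := MeasureTheory.volume) hT.le
      ((Complex.continuous_re.comp hc).intervalIntegrable 0 T)
      (intervalIntegrable_const (c := -(ε / 2))) fun t _ => by
        have h1 := abs_le.1 (hre (torusFlow θ t))
        have h2 := abs_le.1 (hre (torusFlow θ t + z))
        have h3 := hfz t
        have h4 : (f (torusFlow θ t)).re = 0 := by rw [hfA]; rfl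
        simp only [Function.comp_apply, Complex.sub_re]
        linarith [h1.1, h1.2, h2.1, h2.2]
    rw [intervalIntegral.integral_const, sub_zero, smul_eq_mul] at hm
    rw [inv_mul_le_iff₀ hT]
    exact hm
  have := le_of_tendsto hlim hle
  simp only [Complex.zero_re] at this
  linarith

end Kronecker

/-! ### Irreducible pencils and traces over `ℚ(q)`. -/

section ThreeTerm

open Polynomial

/-- The polynomials with `w₀ = c`, `w₁ = X - d` and `wₖ₊₂ = X wₖ₊₁ - wₖ`. -/
def threeTerm (c d : ℚ) : ℕ → ℚ[X]
  | 0 => C c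
  | 1 => X - C d
  | k + 2 => X * threeTerm c d (k + 1) - threeTerm c d k

lemma threeTerm_add_two (c d : ℚ) (k : ℕ) :
    threeTerm c d (k + 2) = X * threeTerm c d (k + 1) - threeTerm c d k := rfl

lemma natDegree_threeTerm_le (c d : ℚ) (k : ℕ) : (threeTerm c d k).natDegree ≤ k := by
  induction k using Nat.twoStepInduction with
  | zero => simp [threeTerm]
  | one => simp [threeTerm]
  | more k h0 h1 =>
    rw [threeTerm_add_two]
    refine (natDegree_sub_le _ _).trans (max_le (natDegree_mul_le.trans ?_) (h0.trans (by lia)))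
    rw [natDegree_X]; lia

lemma coeff_threeTerm_succ (c d : ℚ) (k : ℕ) :
    (threeTerm c d (k + 1)).coeff (k + 1) = 1 ∧ (threeTerm c d (k + 1)).coeff k = -d := by
  induction k with
  | zero => simp [threeTerm]
  | succ k ih =>
    have h0 := natDegree_threeTerm_le c d k
    rw [threeTerm_add_two, coeff_sub, coeff_sub, coeff_X_mul, coeff_X_mul, ih.1, ih.2,
      coeff_eq_zero_of_natDegree_lt (h0.trans_lt (by lia)),
      coeff_eq_zero_of_natDegree_lt (h0.trans_lt (by lia))]
    simp

lemma isCoprime_threeTerm {c : ℚ} (hc : c ≠ 0) (d : ℚ) (k : ℕ) :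
    IsCoprime (threeTerm c d (k + 1)) (threeTerm c d k) := by
  induction k with
  | zero => exact ⟨0, C c⁻¹, by simp [threeTerm, ← C_mul, hc]⟩
  | succ k ih =>
    rw [threeTerm_add_two, sub_eq_neg_add, mul_comm]
    exact (ih.symm.neg_left).add_mul_left_left _

/-- The polynomial `wₖ₊₁ - q wₖ`, with `q` the variable of the coefficient ring. -/
def pencil (c d : ℚ) (k : ℕ) : ℚ[X][X] :=
  (threeTerm c d (k + 1)).map C - C X * (threeTerm c d k).map C

/-- Swapping the variables turns the pencil into a polynomial of degree one with coprime
coefficients. -/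
lemma irreducible_pencil {c : ℚ} (hc : c ≠ 0) (d : ℚ) {k : ℕ} (hk : threeTerm c d k ≠ 0) :
    Irreducible (pencil c d k) := by
  rw [← MulEquiv.irreducible_iff (Bivariate.swap (R := ℚ))]
  have e : Bivariate.swap (pencil c d k) =
      C (-threeTerm c d k) * X + C (threeTerm c d (k + 1)) := by
    rw [pencil, map_sub, map_mul, Bivariate.swap_map_C, Bivariate.swap_map_C, Bivariate.swap_X,
      C_neg]
    ring
  rw [e]
  exact irreducible_C_mul_X_add_C (neg_ne_zero.2 hk)
    (isCoprime_threeTerm hc d k).symm.neg_left.isRelPrime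

lemma natDegree_pencil_le (c d : ℚ) (k : ℕ) : (pencil c d k).natDegree ≤ k + 1 := by
  refine (natDegree_sub_le _ _).trans
    (max_le (natDegree_map_le.trans (natDegree_threeTerm_le c d _)) ?_)
  exact (natDegree_C_mul_le _ _).trans
    (natDegree_map_le.trans ((natDegree_threeTerm_le c d k).trans (by lia)))

lemma coeff_pencil_succ (c d : ℚ) (k : ℕ) : (pencil c d k).coeff (k + 1) = 1 := by
  rw [pencil, coeff_sub, coeff_C_mul, coeff_map, coeff_map, (coeff_threeTerm_succ c d k).1,
    coeff_eq_zero_of_natDegree_lt ((natDegree_threeTerm_le c d k).trans_lt (by lia))]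
  simp

/-- `hk` is automatic for `k ≥ 1`; for `k = 0` it says `c = 1`. -/
lemma coeff_pencil (c d : ℚ) {k : ℕ} (hk : (threeTerm c d k).coeff k = 1) :
    (pencil c d k).coeff k = -(C d + X) := by
  rw [pencil, coeff_sub, coeff_C_mul, coeff_map, coeff_map, (coeff_threeTerm_succ c d k).2, hk]
  simp only [map_neg, map_one]; ring

lemma monic_pencil (c d : ℚ) (k : ℕ) : (pencil c d k).Monic :=
  monic_of_natDegree_le_of_coeff_eq_one _ (natDegree_pencil_le c d k) (coeff_pencil_succ c d k)

lemma natDegree_pencil (c d : ℚ) (k : ℕ) : (pencil c d k).natDegree = k + 1 :=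
  natDegree_eq_of_le_of_coeff_ne_zero (natDegree_pencil_le c d k)
    (by rw [coeff_pencil_succ]; exact one_ne_zero)

/-- A linear relation between algebraic elements passes to their normalised traces. -/
theorem sum_mul_nextCoeff_div_natDegree {K E ι : Type*} [Field K] [CharZero K] [Field E]
    [Algebra K E] [Fintype ι] (x : ι → E) (P : ι → K[X]) (hm : ∀ i, (P i).Monic)
    (hirr : ∀ i, Irreducible (P i)) (hx : ∀ i, aeval (x i) (P i) = 0) (a : ι → K) (s : K)
    (h : ∑ i, algebraMap K E (a i) * x i = algebraMap K E s) :
    ∑ i, a i * (-(P i).nextCoeff / (P i).natDegree) = s := by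
  classical
  have hint : ∀ i, IsIntegral K (x i) := fun i => ⟨P i, hm i, hx i⟩
  have hmin : ∀ i, minpoly K (x i) = P i := fun i =>
    (minpoly.eq_of_irreducible_of_monic (hirr i) (hx i) (hm i)).symm
  let L := IntermediateField.adjoin K (Set.range x)
  have : FiniteDimensional K L := IntermediateField.finiteDimensional_adjoin
    (by rintro _ ⟨i, rfl⟩; exact hint i)
  let y : ι → L := fun i => ⟨x i, IntermediateField.subset_adjoin K _ ⟨i, rfl⟩⟩
  have hy : ∑ i, a i • y i = algebraMap K L s := by
    apply (algebraMap L E).injective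
    rw [map_sum, ← IsScalarTower.algebraMap_apply, ← h]
    refine Finset.sum_congr rfl fun i _ => ?_
    rw [Algebra.smul_def, map_mul, ← IsScalarTower.algebraMap_apply]
    rfl
  have hL : (Module.finrank K L : K) ≠ 0 := Nat.cast_ne_zero.2 Module.finrank_pos.ne'
  have htr : ∀ i, Algebra.trace K L (y i) =
      Module.finrank K L * (-(P i).nextCoeff / (P i).natDegree) := fun i => by
    have hyi : minpoly K (y i) = P i := by
      rw [← hmin i]
      exact (minpoly.algebraMap_eq (algebraMap L E).injective (y i)).symm
    have hd : Module.finrank K (IntermediateField.adjoin K {y i}) = (P i).natDegree := by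
      rw [IntermediateField.adjoin.finrank (IsIntegral.of_finite K (y i)), hyi]
    have hd0 : ((P i).natDegree : K) ≠ 0 := Nat.cast_ne_zero.2 (hirr i).natDegree_pos.ne'
    rw [trace_eq_finrank_mul_minpoly_nextCoeff, hyi,
      ← Module.finrank_mul_finrank K (IntermediateField.adjoin K {y i}) L, hd]
    push_cast
    field_simp
  have := congrArg (Algebra.trace K L) hy
  rw [map_sum, Algebra.trace_algebraMap, nsmul_eq_mul] at this
  simp only [map_smul, htr, smul_eq_mul, mul_left_comm (a _)] at this
  rw [← Finset.mul_sum] at this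
  exact mul_left_cancel₀ hL this

/-- Integer relations between the numbers `q² + 1 - q θᵢ`, where `q` is transcendental and `θᵢ` is
a root of a pencil polynomial. -/
theorem relations_of_pencil_roots {ι : Type*} [Fintype ι] {q : ℝ} (hq : Transcendental ℚ q)
    (θ : ι → ℝ) (c d : ι → ℚ) (k : ι → ℕ) (hc : ∀ i, c i ≠ 0)
    (hk : ∀ i, (threeTerm (c i) (d i) (k i)).coeff (k i) = 1)
    (hθ : ∀ i, aeval (θ i) (threeTerm (c i) (d i) (k i + 1)) =
      q * aeval (θ i) (threeTerm (c i) (d i) (k i)))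
    (l : ι → ℤ) (h : ∑ i, l i * (q ^ 2 + 1 - q * θ i) = 0) :
    ∑ i, (l i : ℚ) = 0 ∧ ∑ i, l i * (d i / (k i + 1)) = 0 ∧ ∑ i, l i * (1 / (k i + 1 : ℚ)) = 0 := by
  -- Transcendence of `q` embeds `ℚ(X)` in `ℝ` by `X ↦ q`, so Gauss's lemma applies and powers of
  -- `q` can be compared.
  let _ : Algebra ℚ[X] ℝ := (aeval q).toRingHom.toAlgebra
  have : FaithfulSMul ℚ[X] ℝ := (faithfulSMul_iff_algebraMap_injective _ _).2
    (transcendental_iff_injective.1 hq)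
  let _ : Algebra (FractionRing ℚ[X]) ℝ := FractionRing.liftAlgebra ℚ[X] ℝ
  let ψ := algebraMap ℚ[X] (FractionRing ℚ[X])
  have hψ : Function.Injective ψ := IsFractionRing.injective _ _
  have htower : ∀ p, algebraMap (FractionRing ℚ[X]) ℝ (ψ p) = aeval q p := fun p =>
    (IsScalarTower.algebraMap_apply ℚ[X] (FractionRing ℚ[X]) ℝ p).symm
  have : CharZero (FractionRing ℚ[X]) := charZero_of_injective_algebraMap hψ
  have hk0 : ∀ i, threeTerm (c i) (d i) (k i) ≠ 0 := fun i h0 => by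
    have := hk i
    simp [h0] at this
  have key := sum_mul_nextCoeff_div_natDegree (K := FractionRing ℚ[X]) θ
    (fun i => (pencil (c i) (d i) (k i)).map ψ) (fun i => (monic_pencil _ _ _).map _)
    (fun i => (monic_pencil _ _ _).irreducible_iff_irreducible_map_fraction_map.1
      (irreducible_pencil (hc i) _ (hk0 i)))
    (fun i => by
      have e : (algebraMap (FractionRing ℚ[X]) ℝ).comp (ψ.comp C) = algebraMap ℚ ℝ :=
        Subsingleton.elim _ _
      rw [pencil, Polynomial.map_sub, Polynomial.map_mul, Polynomial.map_map, Polynomial.map_map,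
        map_C, map_sub, map_mul, aeval_C, htower, aeval_X, aeval_def, aeval_def, eval₂_map,
        eval₂_map, e, ← aeval_def, ← aeval_def, hθ i, sub_self])
    (fun i => ψ (C (l i : ℚ) * X)) (ψ (C (∑ i, (l i : ℚ)) * (X ^ 2 + 1)))
    (by
      simp only [htower, map_mul, aeval_C, aeval_X, map_add, map_pow, map_one, map_sum,
        eq_ratCast, Rat.cast_intCast]
      have : ∑ i, (l i : ℝ) * (q ^ 2 + 1 - q * θ i) =
          (∑ i, (l i : ℝ)) * (q ^ 2 + 1) - ∑ i, (l i : ℝ) * q * θ i := by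
        rw [Finset.sum_mul, ← Finset.sum_sub_distrib]
        exact Finset.sum_congr rfl fun i _ => by ring
      linarith)
  have hterm : ∀ i, ψ (C (l i : ℚ) * X) * (-((pencil (c i) (d i) (k i)).map ψ).nextCoeff /
      ((pencil (c i) (d i) (k i)).map ψ).natDegree) =
      ψ (C (l i * (d i / (k i + 1))) * X + C (l i * (1 / (k i + 1 : ℚ))) * X ^ 2) := fun i => by
    have hd : ((k i : ℚ) + 1) ≠ 0 := by positivity
    have hdeg : ((pencil (c i) (d i) (k i)).map ψ).natDegree = k i + 1 := by
      rw [(monic_pencil _ _ _).natDegree_map, natDegree_pencil]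
    have hdψ : (((k i + 1 : ℕ)) : FractionRing ℚ[X]) = ψ (C ((k i : ℚ) + 1)) := by simp
    have hne : ψ (C ((k i : ℚ) + 1)) ≠ 0 := by
      rw [Ne, map_eq_zero_iff ψ hψ, C_eq_zero]; exact hd
    rw [nextCoeff_of_natDegree_pos (by rw [hdeg]; lia), hdeg, Nat.add_sub_cancel, coeff_map,
      coeff_pencil _ _ (hk i), map_neg, neg_neg, hdψ, mul_div_assoc', div_eq_iff hne, ← map_mul,
      ← map_mul]
    congr 1
    have e1 : C ((l i : ℚ) * (d i / (k i + 1))) * C ((k i : ℚ) + 1) = C (l i : ℚ) * C (d i) := by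
      rw [← C_mul, ← C_mul]; congr 1; field_simp
    have e2 : C ((l i : ℚ) * (1 / (k i + 1 : ℚ))) * C ((k i : ℚ) + 1) = C (l i : ℚ) := by
      rw [← C_mul]; congr 1; field_simp
    linear_combination (-X) * e1 - X ^ 2 * e2
  simp only [hterm] at key
  rw [← map_sum] at key
  have hpoly := hψ key
  rw [Finset.sum_add_distrib, ← Finset.sum_mul, ← Finset.sum_mul, ← map_sum, ← map_sum] at hpoly
  have h0 := congrArg (fun p => coeff p 0) hpoly
  have h1 := congrArg (fun p => coeff p 1) hpoly
  have h2 := congrArg (fun p => coeff p 2) hpoly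
  simp only [coeff_add, coeff_C_mul, coeff_X_pow, coeff_X, coeff_one] at h0 h1 h2
  norm_num at h0 h1 h2
  have h0' : ∑ i, (l i : ℚ) = 0 := by simpa using h0.symm
  refine ⟨h0', by simpa using h1, ?_⟩
  simpa [h0'] using h2

end ThreeTerm

/-! ### Symmetry of eigenvectors and the pencil of each eigenvalue. -/

section PathRecurrence

open Polynomial

/-- The solution of `gₖ₊₂ = θ gₖ₊₁ - gₖ` with `g₀ = 1` and `g₁ = θ - q`. -/
def boundarySeq (q θ : ℝ) : ℕ → ℝ
  | 0 => 1
  | 1 => θ - q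
  | k + 2 => θ * boundarySeq q θ (k + 1) - boundarySeq q θ k

lemma boundarySeq_add_two (q θ : ℝ) (k : ℕ) :
    boundarySeq q θ (k + 2) = θ * boundarySeq q θ (k + 1) - boundarySeq q θ k := rfl

lemma eq_boundarySeq_mul {q θ : ℝ} {n : ℕ} {f : ℕ → ℝ} (h0 : f 1 = (θ - q) * f 0)
    (h : ∀ j, j + 2 < n → f (j + 2) = θ * f (j + 1) - f j) {j : ℕ} (hj : j < n) :
    f j = boundarySeq q θ j * f 0 := by
  induction j using Nat.twoStepInduction with
  | zero => simp [boundarySeq]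
  | one => simpa [boundarySeq] using h0
  | more j h1 h2 =>
    rw [h j hj, h1 (by lia), h2 (by lia), boundarySeq_add_two]; ring

/-- The value at `θ` of the pencil polynomial. -/
def pencilEval (q θ : ℝ) (c d : ℚ) (k : ℕ) : ℝ :=
  aeval θ (threeTerm c d (k + 1)) - q * aeval θ (threeTerm c d k)

lemma pencilEval_add_two (q θ : ℝ) (c d : ℚ) (k : ℕ) :
    pencilEval q θ c d (k + 2) = θ * pencilEval q θ c d (k + 1) - pencilEval q θ c d k := by
  simp only [pencilEval, threeTerm_add_two, map_sub, map_mul, aeval_X]; ring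

lemma eq_of_recurrence {θ : ℝ} {f g : ℕ → ℝ} (hf : ∀ k, f (k + 2) = θ * f (k + 1) - f k)
    (hg : ∀ k, g (k + 2) = θ * g (k + 1) - g k) (h0 : f 0 = g 0) (h1 : f 1 = g 1) (k : ℕ) :
    f k = g k := by
  induction k using Nat.twoStepInduction with
  | zero => exact h0
  | one => exact h1
  | more k a b => rw [hf, hg, a, b]

lemma boundarySeq_sub_eq_pencilEval (q θ : ℝ) (s : ℚ) (k : ℕ) :
    boundarySeq q θ (k + 1) - s * boundarySeq q θ k = pencilEval q θ 1 s k := by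
  refine eq_of_recurrence (θ := θ) (f := fun k => boundarySeq q θ (k + 1) - s * boundarySeq q θ k)
    (fun k => ?_) (pencilEval_add_two q θ 1 s) ?_ ?_ k
  · simp only [boundarySeq_add_two]; ring
  · simp [boundarySeq, pencilEval, threeTerm]; ring
  · simp [boundarySeq, pencilEval, threeTerm]; ring

/-- The start `c = 2` comes from running the recurrence of these differences one step back. -/
lemma boundarySeq_add_two_sub_eq_pencilEval (q θ : ℝ) (k : ℕ) :
    boundarySeq q θ (k + 2) - boundarySeq q θ k = pencilEval q θ 2 0 (k + 1) := by
  refine eq_of_recurrence (θ := θ) (f := fun k => boundarySeq q θ (k + 2) - boundarySeq q θ k)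
    (g := fun k => pencilEval q θ 2 0 (k + 1))
    (fun k => ?_) (fun k => pencilEval_add_two q θ 2 0 (k + 1)) ?_ ?_ k
  · simp only [boundarySeq_add_two]; ring
  · simp [boundarySeq, pencilEval, threeTerm]; ring
  · simp [boundarySeq, pencilEval, threeTerm]; ring

/-- An eigenvector of the path with potential `q` at both ends is symmetric or antisymmetric, and
its eigenvalue is a root of the corresponding pencil polynomial. -/
theorem exists_pencil_root {n : ℕ} (hn : 2 ≤ n) : ∃ α β κ : ℚ, ∀ (q θ : ℝ) (f : ℕ → ℝ),
    (∃ j < n, f j ≠ 0) → f 1 = (θ - q) * f 0 →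
    (∀ j, j + 2 < n → f (j + 2) = θ * f (j + 1) - f j) → f (n - 2) = (θ - q) * f (n - 1) →
    ∃ (s c d : ℚ) (k : ℕ), (s = 1 ∨ s = -1) ∧ f (n - 1) = s * f 0 ∧ c ≠ 0 ∧
      (threeTerm c d k).coeff k = 1 ∧
      aeval θ (threeTerm c d (k + 1)) = q * aeval θ (threeTerm c d k) ∧
      s = α + β * (d / (k + 1)) + κ * (1 / (k + 1)) := by
  have main : ∀ (q θ : ℝ) (f : ℕ → ℝ),
      (∃ j < n, f j ≠ 0) → f 1 = (θ - q) * f 0 →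
      (∀ j, j + 2 < n → f (j + 2) = θ * f (j + 1) - f j) → f (n - 2) = (θ - q) * f (n - 1) →
      ∃ s : ℚ, (s = 1 ∨ s = -1) ∧ f (n - 1) = s * f 0 ∧
        ∀ i j, i + j + 1 = n → boundarySeq q θ i = s * boundarySeq q θ j := by
    intro q θ f hne h0 h h1
    have hfwd : ∀ j < n, f j = boundarySeq q θ j * f 0 := fun j hj => eq_boundarySeq_mul h0 h hj
    have hbwd : ∀ j < n, f (n - 1 - j) = boundarySeq q θ j * f (n - 1) := fun j hj => by
      refine eq_boundarySeq_mul (f := fun j => f (n - 1 - j)) (q := q) (θ := θ) (n := n) ?_ ?_ hj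
      · simpa [show n - 1 - 1 = n - 2 by lia] using h1
      · intro j hj
        have := h (n - 1 - (j + 2)) (by lia)
        rw [show n - 1 - (j + 2) + 2 = n - 1 - j by lia,
          show n - 1 - (j + 2) + 1 = n - 1 - (j + 1) by lia] at this
        linarith
    have hf0 : f 0 ≠ 0 := by
      obtain ⟨j, hj, hfj⟩ := hne
      intro h0
      exact hfj (by rw [hfwd j hj, h0, mul_zero])
    have e1 := hfwd (n - 1) (by lia)
    have e2 := hbwd (n - 1) (by lia)
    rw [Nat.sub_self] at e2
    -- Reading `f` from either end multiplies by the same factor, whose square is therefore `1`.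
    have hsq : (boundarySeq q θ (n - 1) - 1) * (boundarySeq q θ (n - 1) + 1) = 0 := by
      apply mul_right_cancel₀ hf0
      linear_combination (-1 : ℝ) * e2 - boundarySeq q θ (n - 1) * e1
    obtain ⟨s, hs, hsb⟩ : ∃ s : ℚ, (s = 1 ∨ s = -1) ∧ (s : ℝ) = boundarySeq q θ (n - 1) := by
      rcases mul_eq_zero.1 hsq with h | h
      · exact ⟨1, Or.inl rfl, by push_cast; linarith⟩
      · exact ⟨-1, Or.inr rfl, by push_cast; linarith⟩
    refine ⟨s, hs, by rw [hsb]; exact e1, fun i j hij => ?_⟩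
    apply mul_right_cancel₀ hf0
    have hb := hbwd j (by lia)
    rw [show n - 1 - j = i by lia, hfwd i (by lia), e1, ← hsb] at hb
    linear_combination hb
  obtain ⟨m, hm⟩ := Nat.even_or_odd' n
  obtain ⟨k, rfl⟩ : ∃ k, m = k + 1 := ⟨m - 1, by lia⟩
  have hk1 : (k : ℚ) + 1 ≠ 0 := by positivity
  have hone : ∀ d, (threeTerm 1 d k).coeff k = 1 := fun d => by
    cases k with
    | zero => simp [threeTerm]
    | succ k => exact (coeff_threeTerm_succ _ _ _).1
  rcases hm with hm | hm
  -- For even `n` both pencils have degree `k + 1`, and `d = s` carries the sign.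
  · refine ⟨0, k + 1, 0, fun q θ f hne h0 h h1 => ?_⟩
    obtain ⟨s, hs, hfs, hg⟩ := main q θ f hne h0 h h1
    refine ⟨s, 1, s, k, hs, hfs, one_ne_zero, hone s, ?_, by field_simp; ring⟩
    have e := boundarySeq_sub_eq_pencilEval q θ s k
    rw [hg (k + 1) k (by lia), sub_self] at e
    exact sub_eq_zero.1 e.symm
  -- For odd `n` both have `d = 0`; the degree, `k + 2` or `k + 1`, tells the sign `1` from `-1`.
  · refine ⟨2 * k + 3, 0, -(2 * (k + 1) * (k + 2)), fun q θ f hne h0 h h1 => ?_⟩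
    obtain ⟨s, hs, hfs, hg⟩ := main q θ f hne h0 h h1
    rcases hs with rfl | rfl
    · refine ⟨1, 2, 0, k + 1, Or.inl rfl, hfs, two_ne_zero, (coeff_threeTerm_succ _ _ _).1, ?_, ?_⟩
      · have e := boundarySeq_add_two_sub_eq_pencilEval q θ k
        rw [hg (k + 2) k (by lia), Rat.cast_one, one_mul, sub_self] at e
        exact sub_eq_zero.1 e.symm
      · have hk2 : (k : ℚ) + 1 + 1 ≠ 0 := by positivity
        push_cast; field_simp; ring
    · refine ⟨-1, 1, 0, k, Or.inr rfl, hfs, one_ne_zero, hone 0, ?_, by field_simp; ring⟩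
      have e := boundarySeq_sub_eq_pencilEval q θ 0 k
      have e' := hg (k + 1) (k + 1) (by lia)
      push_cast at e e'
      rw [show boundarySeq q θ (k + 1) = 0 by linarith, zero_mul, sub_self] at e
      exact sub_eq_zero.1 e.symm

end PathRecurrence

/-! ### Eigenvector equations of the `q`-Laplacian. -/

namespace QLaplacian

lemma qLapMatrix_mulVec_apply {V : Type*} [Fintype V] [DecidableEq V] (G : SimpleGraph V)
    [DecidableRel G.Adj] (q : ℝ) (v : V → ℝ) (i : V) :
    (qLapMatrix G q *ᵥ v) i = q * (G.degree i * v i - ∑ u ∈ G.neighborFinset i, v u) -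
      (q - 1) * v i + q * (q - 1) * (G.degree i * v i - v i) := by
  simp [qLapMatrix, Matrix.add_mulVec, Matrix.sub_mulVec, Matrix.smul_mulVec,
    SimpleGraph.lapMatrix_mulVec_apply, SimpleGraph.degMatrix, Matrix.mulVec_diagonal]

lemma isHermitian_qLapMatrix {V : Type*} [Fintype V] [DecidableEq V] (G : SimpleGraph V)
    [DecidableRel G.Adj] (q : ℝ) : (qLapMatrix G q).IsHermitian := by
  rw [Matrix.IsHermitian, conjTranspose_eq_transpose_of_trivial, qLapMatrix]
  simp [Matrix.transpose_add, Matrix.transpose_sub, SimpleGraph.degMatrix,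
    (SimpleGraph.isSymm_lapMatrix ℝ G).eq]

/-- The eigenvector equations of the `q`-Laplacian of a path, as a recurrence. -/
lemma pathGraph_eigenvector {n : ℕ} (hn : 2 ≤ n) {q μ θ : ℝ} (hq : q ≠ 0)
    (hθ : μ = q ^ 2 + 1 - q * θ) {v : Fin n → ℝ}
    (hv : qLapMatrix (SimpleGraph.pathGraph n) q *ᵥ v = μ • v) {f : ℕ → ℝ}
    (hf : ∀ i : Fin n, f i = v i) :
    f 1 = (θ - q) * f 0 ∧ (∀ j, j + 2 < n → f (j + 2) = θ * f (j + 1) - f j) ∧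
      f (n - 2) = (θ - q) * f (n - 1) := by
  have key : ∀ (i : Fin n) (s : Finset (Fin n)),
      (∀ u, (SimpleGraph.pathGraph n).Adj i u ↔ u ∈ s) →
      q * (s.card * f i - ∑ u ∈ s, f u) - (q - 1) * f i + q * (q - 1) * (s.card * f i - f i) =
        μ * f i := by
    intro i s hs
    have e : (SimpleGraph.pathGraph n).neighborFinset i = s := by
      ext u; rw [SimpleGraph.mem_neighborFinset]; exact hs u
    have h := congrFun hv i
    rw [qLapMatrix_mulVec_apply, ← SimpleGraph.card_neighborFinset_eq_degree, e] at h
    simpa [hf] using h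
  refine ⟨?_, fun j hj => ?_, ?_⟩
  · have h := key ⟨0, by lia⟩ {⟨1, by lia⟩} fun u => by
      simp only [SimpleGraph.pathGraph_adj, Finset.mem_singleton, Fin.ext_iff]; lia
    simp only [Finset.card_singleton, Finset.sum_singleton, hθ] at h
    apply mul_left_cancel₀ hq
    push_cast at h
    linear_combination -h
  · have h := key ⟨j + 1, by lia⟩ {⟨j, by lia⟩, ⟨j + 2, by lia⟩} fun u => by
      simp only [SimpleGraph.pathGraph_adj, Finset.mem_singleton, Finset.mem_insert, Fin.ext_iff]
      lia
    have hne : (⟨j, by lia⟩ : Fin n) ≠ ⟨j + 2, by lia⟩ := by simp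
    rw [Finset.card_pair hne, Finset.sum_pair hne, hθ] at h
    apply mul_left_cancel₀ hq
    push_cast at h
    linear_combination -h
  · have h := key ⟨n - 1, by lia⟩ {⟨n - 2, by lia⟩} fun u => by
      simp only [SimpleGraph.pathGraph_adj, Finset.mem_singleton, Fin.ext_iff]; lia
    simp only [Finset.card_singleton, Finset.sum_singleton, hθ] at h
    apply mul_left_cancel₀ hq
    push_cast at h
    linear_combination -h

end QLaplacian

/-! ### From integer relations to PGST. -/

namespace QLaplacian

variable {V : Type*} [Fintype V] [DecidableEq V]

lemma exp_mulVec_of_mulVec_eq_smul {A : Matrix V V ℂ} {v : V → ℂ} {c : ℂ}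
    (h : A *ᵥ v = c • v) : NormedSpace.exp A *ᵥ v = Complex.exp c • v := by
  let _ : NormedRing (Matrix V V ℂ) := Matrix.linftyOpNormedRing
  let _ : NormedAlgebra ℂ (Matrix V V ℂ) := Matrix.linftyOpNormedAlgebra
  have hpow : ∀ k : ℕ, A ^ k *ᵥ v = c ^ k • v := fun k => by
    induction k with
    | zero => simp
    | succ k ih => rw [pow_succ', ← mulVec_mulVec, ih, mulVec_smul, h, smul_smul, pow_succ]
  have h1 : HasSum (fun k : ℕ => ((k.factorial : ℂ)⁻¹ • A ^ k) *ᵥ v)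
      (NormedSpace.exp A *ᵥ v) :=
    (NormedSpace.exp_series_hasSum_exp' (𝕂 := ℂ) A).map
      (Matrix.mulVecBilin ℂ ℂ |>.flip v : Matrix V V ℂ →ₗ[ℂ] (V → ℂ))
      (LinearMap.continuous_of_finiteDimensional _)
  have h2 : HasSum (fun k : ℕ => ((k.factorial : ℂ)⁻¹ • c ^ k) • v) (Complex.exp c • v) := by
    rw [Complex.exp_eq_exp_ℂ]
    exact (NormedSpace.exp_series_hasSum_exp' (𝕂 := ℂ) c).smul_const v
  simp only [smul_mulVec, hpow, smul_smul] at h1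
  exact h1.unique h2

lemma transitionMatrix_mulVec_of_mulVec_eq_smul {M : Matrix V V ℝ} {v : V → ℝ} {μ : ℝ}
    (h : M *ᵥ v = μ • v) (t : ℝ) :
    transitionMatrix M t *ᵥ (fun j => (v j : ℂ)) =
      Complex.exp (Complex.I * t * μ) • fun j => (v j : ℂ) := by
  refine exp_mulVec_of_mulVec_eq_smul ?_
  ext j
  have := (RingHom.map_mulVec Complex.ofRealHom M v j).symm
  rw [h] at this
  simp only [smul_mulVec, Pi.smul_apply, smul_eq_mul, mul_assoc] at this ⊢
  congr 2
  exact this.trans (by simp)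

lemma fourier_one_quarter {s : ℚ} (hs : s = 1 ∨ s = -1) :
    (fourier 1 (((1 - s) / 4 : ℝ) : UnitAddCircle) : ℂ) = s := by
  rw [fourier_coe_apply]
  rcases hs with rfl | rfl
  · simp
  · rw [show (((-1 : ℚ) : ℂ)) = -1 by norm_num, ← Complex.exp_pi_mul_I]
    congr 1
    push_cast
    ring

/-- Strongly cospectral states have PGST if the eigenvalues satisfy only those integer relations
that the signs allow. -/
theorem hasPGST_of_relations {M : Matrix V V ℝ} (hM : M.IsHermitian) {x y : V → ℝ}
    (hx : IsState x) (hy : IsState y) (hxy : LinearIndependent ℝ ![x, y]) (s : V → ℚ)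
    (hs : ∀ i, s i = 1 ∨ s i = -1)
    (hsxy : ∀ i, ⇑(hM.eigenvectorBasis i) ⬝ᵥ y = s i * (⇑(hM.eigenvectorBasis i) ⬝ᵥ x))
    (hrel : ∀ l : V → ℤ, ∑ i, l i * hM.eigenvalues i = 0 →
      ∑ i, (l i : ℚ) = 0 ∧ ∑ i, l i * s i = 0) : HasPGST M x y := by
  have hexp : ∀ x : V → ℝ, (fun j => (x j : ℂ)) =
      ∑ i, ((⇑(hM.eigenvectorBasis i) ⬝ᵥ x : ℝ) : ℂ) • fun j => (hM.eigenvectorBasis i j : ℂ) := by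
    intro x
    ext j
    have := congrArg (fun v => v j) (hM.eigenvectorBasis.sum_repr' (WithLp.toLp 2 x))
    simp only [WithLp.ofLp_sum, Finset.sum_apply, WithLp.ofLp_smul, Pi.smul_apply,
      EuclideanSpace.inner_eq_star_dotProduct, star_trivial, smul_eq_mul] at this
    simp only [Finset.sum_apply, Pi.smul_apply, smul_eq_mul]
    rw [← this]
    push_cast
    exact Finset.sum_congr rfl fun i _ => by rw [dotProduct_comm]
  -- The target phase is `0` for sign `1` and half a turn for sign `-1`.
  let z : UnitAddTorus V := fun i => (((1 - s i) / 4 : ℝ) : UnitAddCircle)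
  have hz : ∀ l : V → ℤ, ∑ i, l i * hM.eigenvalues i = 0 → ∑ i, l i • z i = 0 := by
    intro l hl
    obtain ⟨h1, h2⟩ := hrel l hl
    have h3 : ∑ i, (l i : ℝ) * ((1 - s i) / 4) = 0 := by
      have : ∑ i, (l i : ℚ) * ((1 - s i) / 4) = 0 := by
        have : ∑ i, (l i : ℚ) * ((1 - s i) / 4) = (∑ i, (l i : ℚ) - ∑ i, l i * s i) / 4 := by
          rw [← Finset.sum_sub_distrib, Finset.sum_div]
          exact Finset.sum_congr rfl fun i _ => by ring
        rw [this, h1, h2]; norm_num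
      exact_mod_cast congrArg (Rat.cast : ℚ → ℝ) this
    have h4 := congrArg (QuotientAddGroup.mk' (AddSubgroup.zmultiples (1 : ℝ))) h3
    rw [map_sum, map_zero] at h4
    rw [← h4]
    refine Finset.sum_congr rfl fun i _ => ?_
    rw [← zsmul_eq_mul, map_zsmul]
    rfl
  choose t ht using fun k : ℕ => exists_dist_torusFlow_lt hM.eigenvalues z hz
    (Nat.one_div_pos_of_nat (α := ℝ) (n := k))
  have hlim : Tendsto (fun k => torusFlow hM.eigenvalues (t k)) atTop (𝓝 z) :=
    tendsto_iff_dist_tendsto_zero.2 (squeeze_zero (fun _ => dist_nonneg) (fun k => (ht k).le)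
      tendsto_one_div_add_atTop_nhds_zero_nat)
  refine ⟨hx, hy, hxy, 1, fun k => 2 * Real.pi * t k, norm_one, ?_⟩
  rw [one_smul, hexp y]
  simp only [hexp x, mulVec_sum, mulVec_smul,
    transitionMatrix_mulVec_of_mulVec_eq_smul (hM.mulVec_eigenvectorBasis _)]
  refine tendsto_finsetSum _ fun i _ => ?_
  have hi := ((fourier (T := (1 : ℝ)) 1).continuous.tendsto (z i)).comp
    ((tendsto_pi_nhds.1 hlim) i)
  rw [fourier_one_quarter (hs i)] at hi
  rw [hsxy i, Complex.ofReal_mul, mul_comm, ← smul_smul, Complex.ofReal_ratCast, smul_comm]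
  refine ((hi.smul_const _).const_smul _).congr fun k => ?_
  congr 2
  simp only [Function.comp_apply, torusFlow, fourier_coe_apply]
  congr 1
  push_cast
  ring

end QLaplacian

end

theorem mainTheorem9 (n : ℕ) (hn : 2 ≤ n) :
    ∃ q : ℝ, q ≠ 0 ∧
      QLaplacian.HasVertexPGST (SimpleGraph.pathGraph n) q
        (⟨0, by omega⟩ : Fin n) (⟨n - 1, by omega⟩ : Fin n) := by
  obtain ⟨q, hq⟩ : ∃ q : ℝ, Transcendental ℚ q :=
    ⟨liouvilleNumber 2, fun h => transcendental_liouvilleNumber le_rfl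
      ((IsFractionRing.isAlgebraic_iff ℤ ℚ ℝ).2 h)⟩
  have hq0 : q ≠ 0 := by
    rintro rfl
    exact hq isAlgebraic_zero
  refine ⟨q, hq0, ?_⟩
  have hM := QLaplacian.isHermitian_qLapMatrix (SimpleGraph.pathGraph n) q
  obtain ⟨α, β, κ, hroot⟩ := exists_pencil_root hn
  let θ : Fin n → ℝ := fun i => (q ^ 2 + 1 - hM.eigenvalues i) / q
  have hθ : ∀ i, hM.eigenvalues i = q ^ 2 + 1 - q * θ i := fun i => by
    simp only [θ]; field_simp; ring
  -- The value `0` beyond the path is never used: the recurrence stops at index `n - 1`.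
  let f : Fin n → ℕ → ℝ := fun i j => if h : j < n then hM.eigenvectorBasis i ⟨j, h⟩ else 0
  have hf : ∀ i j (h : j < n), f i j = hM.eigenvectorBasis i ⟨j, h⟩ := fun i j h => dif_pos h
  have hdata := fun i => by
    obtain ⟨h1, h2, h3⟩ := QLaplacian.pathGraph_eigenvector hn hq0 (hθ i)
      (hM.mulVec_eigenvectorBasis i) (f := f i) fun j => hf i j j.2
    refine hroot q (θ i) (f i) ?_ h1 h2 h3
    by_contra! hzero
    refine hM.eigenvectorBasis.orthonormal.ne_zero i ?_
    ext j
    rw [← hf i j j.2, hzero j j.2]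
    rfl
  choose s c d k hs hsym hc hk hpencil hsum using hdata
  refine QLaplacian.hasPGST_of_relations hM ?_ ?_ ?_ s hs (fun i => ?_) fun l hl => ?_
  · simp [QLaplacian.IsState, QLaplacian.vertexState]
  · simp [QLaplacian.IsState, QLaplacian.vertexState]
  · have hne : (⟨0, by omega⟩ : Fin n) ≠ ⟨n - 1, by omega⟩ := by
      simp only [Ne, Fin.mk.injEq]; omega
    rw [LinearIndependent.pair_iff]
    intro a b hab
    have ha := congrFun hab ⟨0, by omega⟩
    have hb := congrFun hab ⟨n - 1, by omega⟩
    simp [QLaplacian.vertexState, hne, hne.symm] at ha hb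
    exact ⟨ha, hb⟩
  · simp only [QLaplacian.vertexState, dotProduct_single, mul_one]
    rw [← hf, ← hf]
    exact hsym i
  · obtain ⟨h0, h1, h2⟩ := relations_of_pencil_roots hq θ c d k hc hk hpencil l
      (by simpa only [hθ] using hl)
    refine ⟨h0, ?_⟩
    have : ∑ i, l i * s i = α * ∑ i, (l i : ℚ) + β * ∑ i, l i * (d i / (k i + 1)) +
        κ * ∑ i, l i * (1 / (k i + 1 : ℚ)) := by
      rw [Finset.mul_sum, Finset.mul_sum, Finset.mul_sum, ← Finset.sum_add_distrib,
        ← Finset.sum_add_distrib]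
      exact Finset.sum_congr rfl fun i _ => by rw [hsum i]; ring
    rw [this, h0, h1, h2]; ring
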